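/- Let $q \ge 0$ and $m \ge 0$ be integers, and let $K_1, \dots, K_m \subset \mathbb{R}^2$ be compact convex sets that are centrally symmetric about the origin, i.e. $-K_i = K_i$ for every $i$. Then there is a real polynomial $p(\lambda_1, \dots, \lambda_m)$, all of whose coefficients are nonnegative, such that for all $\lambda_1, \dots, \lambda_m \ge 0$ $$\int_{\lambda_1 K_1 + \dots + \lambda_m K_m} |s|^{2q} \, ds = p(\lambda_1, \dots, \lambda_m),$$ where $\lambda_1 K_1 + \dots + \lambda_m K_m$ is the Minkowski sum (which is $\{0\}$ when $m = 0$), $|\cdot|$ is the Euclidean norm and $ds$ is Lebesgue measure on $\mathbb{R}^2$. -/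

import Mathlib

open MeasureTheory
open scoped Pointwise

open Filter Topology Set

/-! ### Convex functions on the line -/

namespace ConvexOn

variable {h : ℝ → ℝ}

/-! The weight `‖z‖ ^ (2 * q)` is a positive multiple of a sum of powers `re ^ (2 * q)` over `q + 1`
rotations (`exists_norm_pow_eq_sum_re_pow`), so it suffices to treat `∫ z in K, z.re ^ (2 * q)`.

For this moment, describe a symmetric body by data that add under Minkowski sums: the half-width
`X`, the length `F` of the vertical face, and the right derivative `a(m)` of the support function in
direction `(m, -1)`. The ends of the slice at abscissa `x` are minima over `m` of convex functions
of `m`. Recovering these minima from derivatives gives slice length `F + ∫ (X - max x |a(m)|) dm`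
(`volume_slice`). Integrating against `x ^ (2 * q)` and exchanging integrals shows that the moment
is a positive combination of `F * X ^ (2q+1)` and `∫ (X ^ (2q+2) - a(m) ^ (2q+2)) dm`
(`integral_re_pow`).

For `∑ λᵢ Kᵢ` each of `F`, `X`, `a(m)` is linear in `λ`. Expanding the powers gives coefficients
built from `Fᵢ`, `Xᵢ` and `∫ (∏ X - ∏ a)`, all nonnegative because `|aᵢ(m)| ≤ Xᵢ`. -/

theorem hasDerivWithinAt_rightDeriv_univ (hh : ConvexOn ℝ univ h) (x : ℝ) :
    HasDerivWithinAt h (derivWithin h (Ioi x) x) (Ioi x) x :=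
  hh.hasDerivWithinAt_rightDeriv_of_mem_interior (by simp)

theorem monotone_rightDeriv_univ (hh : ConvexOn ℝ univ h) :
    Monotone fun x => derivWithin h (Ioi x) x := by
  have := hh.monotoneOn_rightDeriv
  rwa [interior_univ, monotoneOn_univ] at this

theorem integral_rightDeriv (hh : ConvexOn ℝ univ h) (s t : ℝ) :
    ∫ x in s..t, derivWithin h (Ioi x) x = h t - h s := by
  refine intervalIntegral.integral_eq_sub_of_hasDeriv_right ?_ (fun x _ => ?_) ?_
  · exact ((hh.continuousOn isOpen_univ).mono (subset_univ _))
  · exact hh.hasDerivWithinAt_rightDeriv_univ x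
  · exact hh.monotone_rightDeriv_univ.intervalIntegrable

theorem rightDeriv_nonneg_of_min (hh : ConvexOn ℝ univ h) {m₀ m : ℝ} (hmin : ∀ y, h m₀ ≤ h y)
    (hm : m₀ ≤ m) : 0 ≤ derivWithin h (Ioi m) m := by
  refine le_trans ?_ (hh.monotone_rightDeriv_univ hm)
  refine ge_of_tendsto
    ((hasDerivWithinAt_iff_tendsto_slope' self_notMem_Ioi).mp
      (hh.hasDerivWithinAt_rightDeriv_univ m₀)) ?_
  filter_upwards [self_mem_nhdsWithin] with y hy
  rw [slope_def_field]
  exact div_nonneg (sub_nonneg.2 (hmin y)) (sub_nonneg.2 (le_of_lt hy))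

theorem rightDeriv_nonpos_of_min (hh : ConvexOn ℝ univ h) {m₀ m : ℝ} (hmin : ∀ y, h m₀ ≤ h y)
    (hm : m < m₀) : derivWithin h (Ioi m) m ≤ 0 := by
  refine (hh.rightDeriv_le_slope_of_mem_interior (by simp) (mem_univ m₀) hm).trans ?_
  rw [slope_def_field]
  exact div_nonpos_of_nonpos_of_nonneg (sub_nonpos.2 (hmin m)) (sub_nonneg.2 hm.le)

/-- The minimum of a convex function recovered from the value at a point to its right. -/
theorem min_eq_sub_integral_posPart (hh : ConvexOn ℝ univ h) {m₀ R : ℝ}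
    (hmin : ∀ y, h m₀ ≤ h y) (h1 : -R ≤ m₀) (h2 : m₀ ≤ R) :
    h m₀ = h R - ∫ x in (-R)..R, max (derivWithin h (Ioi x) x) 0 := by
  have hmono : Monotone fun x => max (derivWithin h (Ioi x) x) 0 :=
    fun x y hxy => max_le_max (hh.monotone_rightDeriv_univ hxy) le_rfl
  rw [← intervalIntegral.integral_add_adjacent_intervals (b := m₀)
    hmono.intervalIntegrable hmono.intervalIntegrable]
  have e1 : ∫ x in (-R)..m₀, max (derivWithin h (Ioi x) x) 0 = ∫ x in (-R)..m₀, (0 : ℝ) := by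
    refine intervalIntegral.integral_congr_ae ?_
    -- At a kink the right derivative at `m₀` itself may be positive, so this point is discarded.
    have : ∀ᵐ x : ℝ, x ≠ m₀ := by simp [ae_iff]
    filter_upwards [this] with x hx hx'
    rw [uIoc_of_le h1] at hx'
    exact max_eq_right (hh.rightDeriv_nonpos_of_min hmin (lt_of_le_of_ne hx'.2 hx))
  have e2 : ∫ x in m₀..R, max (derivWithin h (Ioi x) x) 0 =
      ∫ x in m₀..R, derivWithin h (Ioi x) x := by
    refine intervalIntegral.integral_congr fun x hx => ?_
    rw [uIcc_of_le h2] at hx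
    exact max_eq_left (hh.rightDeriv_nonneg_of_min hmin hx.1)
  rw [e1, e2, hh.integral_rightDeriv]
  simp

/-- The minimum of a convex function recovered from the value at a point to its left. -/
theorem min_eq_sub_integral_negPart (hh : ConvexOn ℝ univ h) {m₀ R : ℝ}
    (hmin : ∀ y, h m₀ ≤ h y) (h1 : -R ≤ m₀) (h2 : m₀ ≤ R) :
    h m₀ = h (-R) - ∫ x in (-R)..R, max (-derivWithin h (Ioi x) x) 0 := by
  have hmono : Monotone fun x => max (derivWithin h (Ioi x) x) 0 :=
    fun x y hxy => max_le_max (hh.monotone_rightDeriv_univ hxy) le_rfl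
  have e : ∀ x, max (-derivWithin h (Ioi x) x) 0 =
      max (derivWithin h (Ioi x) x) 0 - derivWithin h (Ioi x) x := by
    intro x
    rcases le_total 0 (derivWithin h (Ioi x) x) with hx | hx
    · rw [max_eq_right (by linarith), max_eq_left hx]; ring
    · rw [max_eq_left (by linarith), max_eq_right hx]; ring
  simp_rw [e]
  rw [intervalIntegral.integral_sub hmono.intervalIntegrable
    hh.monotone_rightDeriv_univ.intervalIntegrable, hh.integral_rightDeriv]
  have := hh.min_eq_sub_integral_posPart hmin h1 h2
  linarith

end ConvexOn

/-! ### Support functions of planar sets -/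

/-- The support function of a set, evaluated at a linear functional. -/
noncomputable def supportFun {E : Type*} [NormedAddCommGroup E] [NormedSpace ℝ E]
    (K : Set E) (φ : E →L[ℝ] ℝ) : ℝ := sSup (φ '' K)

section supportFun

variable {E : Type*} [NormedAddCommGroup E] [NormedSpace ℝ E] {K : Set E}

theorem le_supportFun (hK : IsCompact K) (φ : E →L[ℝ] ℝ) {z : E} (hz : z ∈ K) :
    φ z ≤ supportFun K φ :=
  le_csSup (hK.image φ.continuous).bddAbove (mem_image_of_mem _ hz)

theorem supportFun_le (hne : K.Nonempty) (φ : E →L[ℝ] ℝ) {c : ℝ} (hc : ∀ z ∈ K, φ z ≤ c) :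
    supportFun K φ ≤ c :=
  csSup_le (hne.image _) (by rintro _ ⟨z, hz, rfl⟩; exact hc z hz)

theorem exists_eq_supportFun (hK : IsCompact K) (hne : K.Nonempty) (φ : E →L[ℝ] ℝ) :
    ∃ z ∈ K, φ z = supportFun K φ := by
  obtain ⟨z, hz, h⟩ := (hK.image φ.continuous).sSup_mem (hne.image _)
  exact ⟨z, hz, h⟩

theorem supportFun_smul_set (φ : E →L[ℝ] ℝ) {c : ℝ} (hc : 0 ≤ c) :
    supportFun (c • K) φ = c * supportFun K φ := by
  unfold supportFun
  rw [image_smul_set, Real.sSup_smul_of_nonneg hc, smul_eq_mul]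

theorem supportFun_add_set {L : Set E} (hK : IsCompact K) (hL : IsCompact L) (hK' : K.Nonempty)
    (hL' : L.Nonempty) (φ : E →L[ℝ] ℝ) :
    supportFun (K + L) φ = supportFun K φ + supportFun L φ := by
  unfold supportFun
  rw [image_add]
  exact csSup_add (hK'.image _) (hK.image φ.continuous).bddAbove (hL'.image _)
    (hL.image φ.continuous).bddAbove

omit [NormedSpace ℝ E] in
theorem isCompact_finsetSum_set {ι : Type*} (s : Finset ι) (K : ι → Set E)
    (hK : ∀ i ∈ s, IsCompact (K i)) : IsCompact (∑ i ∈ s, K i) := by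
  classical
  induction s using Finset.induction_on with
  | empty => simp
  | insert a s ha ih =>
    rw [Finset.sum_insert ha]
    exact (hK a (by simp)).add (ih fun i hi => hK i (by simp [hi]))

omit [NormedSpace ℝ E] in
theorem nonempty_finsetSum_set {ι : Type*} (s : Finset ι) (K : ι → Set E)
    (hK : ∀ i ∈ s, (K i).Nonempty) : (∑ i ∈ s, K i).Nonempty := by
  classical
  induction s using Finset.induction_on with
  | empty => simp
  | insert a s ha ih =>
    rw [Finset.sum_insert ha]
    exact (hK a (by simp)).add (ih fun i hi => hK i (by simp [hi]))

theorem convex_finsetSum_set {ι : Type*} (s : Finset ι) (K : ι → Set E)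
    (hK : ∀ i ∈ s, Convex ℝ (K i)) : Convex ℝ (∑ i ∈ s, K i) := by
  classical
  induction s using Finset.induction_on with
  | empty => simpa using convex_zero
  | insert a s ha ih =>
    rw [Finset.sum_insert ha]
    exact (hK a (by simp)).add (ih fun i hi => hK i (by simp [hi]))

omit [NormedSpace ℝ E] in
theorem neg_finsetSum_set {ι : Type*} (s : Finset ι) (K : ι → Set E)
    (hK : ∀ i ∈ s, -K i = K i) : -(∑ i ∈ s, K i) = ∑ i ∈ s, K i := by
  classical
  induction s using Finset.induction_on with
  | empty => simp
  | insert a s ha ih =>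
    rw [Finset.sum_insert ha, neg_add, hK a (by simp), ih fun i hi => hK i (by simp [hi])]

theorem supportFun_finsetSum_set {ι : Type*} (s : Finset ι) (K : ι → Set E)
    (hK : ∀ i ∈ s, IsCompact (K i)) (hne : ∀ i ∈ s, (K i).Nonempty) (φ : E →L[ℝ] ℝ) :
    supportFun (∑ i ∈ s, K i) φ = ∑ i ∈ s, supportFun (K i) φ := by
  classical
  induction s using Finset.induction_on with
  | empty => simp [supportFun]
  | insert a s ha ih =>
    rw [Finset.sum_insert ha, Finset.sum_insert ha, supportFun_add_set (hK a (by simp))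
      (isCompact_finsetSum_set s K fun i hi => hK i (by simp [hi])) (hne a (by simp))
      (nonempty_finsetSum_set s K fun i hi => hne i (by simp [hi])),
      ih (fun i hi => hK i (by simp [hi])) (fun i hi => hne i (by simp [hi]))]

end supportFun

/-! ### Lower support function of a symmetric planar body -/

/-- The functional `z ↦ m * re z - im z`, whose maximisers on a body are its lower support points
of slope `m`. -/
noncomputable def slopeFunctional (m : ℝ) : ℂ →L[ℝ] ℝ := m • Complex.reCLM - Complex.imCLM

@[simp] theorem slopeFunctional_apply (m : ℝ) (z : ℂ) :
    slopeFunctional m z = m * z.re - z.im := by simp [slopeFunctional]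

/-- The support function in the direction `(m, -1)`. -/
noncomputable def lowerSupport (K : Set ℂ) (m : ℝ) : ℝ := supportFun K (slopeFunctional m)

/-- Half of the width of a symmetric set along the real axis. -/
noncomputable def halfWidth (K : Set ℂ) : ℝ := supportFun K Complex.reCLM

/-- The abscissa of the rightmost lower support point of slope `m`. -/
noncomputable def contactAbscissa (K : Set ℂ) (m : ℝ) : ℝ :=
  derivWithin (lowerSupport K) (Ioi m) m

/-- The length of the vertical face, up to the error made by using slopes at most `R`. -/
noncomputable def faceGap (K : Set ℂ) (R : ℝ) : ℝ :=
  lowerSupport K R + lowerSupport K (-R) - 2 * R * halfWidth K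

/-- The length of the vertical face. -/
noncomputable def faceLength (K : Set ℂ) : ℝ := limUnder atTop (faceGap K)

section

variable {K : Set ℂ}

theorem neg_mem_of_symm (hs : -K = K) {z : ℂ} (hz : z ∈ K) : -z ∈ K := by
  rw [← hs]; simpa using hz

theorem abs_re_le_halfWidth (hc : IsCompact K) (hs : -K = K) {z : ℂ} (hz : z ∈ K) :
    |z.re| ≤ halfWidth K := by
  have h1 := le_supportFun hc Complex.reCLM hz
  have h2 := le_supportFun hc Complex.reCLM (neg_mem_of_symm hs hz)
  simp only [Complex.reCLM_apply, Complex.neg_re] at h1 h2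
  exact abs_le'.2 ⟨h1, h2⟩

theorem halfWidth_nonneg (hc : IsCompact K) (hne : K.Nonempty) (hs : -K = K) :
    0 ≤ halfWidth K := by
  obtain ⟨z, hz⟩ := hne
  exact (abs_nonneg _).trans (abs_re_le_halfWidth hc hs hz)

theorem sub_le_lowerSupport (hc : IsCompact K) (m : ℝ) {z : ℂ} (hz : z ∈ K) :
    m * z.re - z.im ≤ lowerSupport K m :=
  (slopeFunctional_apply m z).symm.trans_le (le_supportFun hc (slopeFunctional m) hz)

/-- Each `m ↦ m * z.re - z.im` has slope at most the half-width in absolute value, and a supremum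
inherits the Lipschitz constant. -/
theorem lowerSupport_le_add (hc : IsCompact K) (hne : K.Nonempty) (hs : -K = K) (m m' : ℝ) :
    lowerSupport K m' ≤ lowerSupport K m + halfWidth K * |m' - m| := by
  refine supportFun_le hne _ fun z hz => ?_
  have h1 := sub_le_lowerSupport hc m hz
  have h2 := abs_re_le_halfWidth hc hs hz
  have h3 : (m' - m) * z.re ≤ halfWidth K * |m' - m| := by
    refine (le_abs_self _).trans ?_
    rw [abs_mul, mul_comm]
    gcongr
  simp only [slopeFunctional_apply]
  linarith

theorem convexOn_lowerSupport (hc : IsCompact K) (hne : K.Nonempty) :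
    ConvexOn ℝ univ (lowerSupport K) := by
  refine ⟨convex_univ, fun x _ y _ a b ha hb hab => supportFun_le hne _ fun z hz => ?_⟩
  have h1 := mul_le_mul_of_nonneg_left (sub_le_lowerSupport hc x hz) ha
  have h2 := mul_le_mul_of_nonneg_left (sub_le_lowerSupport hc y hz) hb
  have h3 : z.im = a * z.im + b * z.im := by rw [← add_mul, hab, one_mul]
  simp only [slopeFunctional_apply, smul_eq_mul]
  linarith

theorem monotone_contactAbscissa (hc : IsCompact K) (hne : K.Nonempty) :
    Monotone (contactAbscissa K) :=
  (convexOn_lowerSupport hc hne).monotone_rightDeriv_univ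

/-- The Lipschitz bound on difference quotients passes to the limit. All nonnegativity of
coefficients involving `contactAbscissa` rests on this. -/
theorem abs_contactAbscissa_le (hc : IsCompact K) (hne : K.Nonempty) (hs : -K = K) (m : ℝ) :
    |contactAbscissa K m| ≤ halfWidth K := by
  have ht := (hasDerivWithinAt_iff_tendsto_slope' self_notMem_Ioi).mp
      ((convexOn_lowerSupport hc hne).hasDerivWithinAt_rightDeriv_univ m)
  refine le_of_tendsto ht.abs ?_
  filter_upwards [self_mem_nhdsWithin] with y hy
  have hy' : 0 < y - m := sub_pos.2 hy
  rw [slope_def_field, abs_div, abs_of_pos hy', div_le_iff₀ hy', abs_le]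
  have h1 := lowerSupport_le_add hc hne hs m y
  have h2 := lowerSupport_le_add hc hne hs y m
  rw [abs_of_pos hy'] at h1
  rw [abs_sub_comm, abs_of_pos hy'] at h2
  constructor <;> linarith

theorem exists_re_eq_halfWidth (hc : IsCompact K) (hne : K.Nonempty) :
    ∃ z ∈ K, z.re = halfWidth K :=
  exists_eq_supportFun hc hne Complex.reCLM

/-- Test slope `R` at a rightmost point `z` and slope `-R` at `-z`; the imaginary parts cancel. -/
theorem faceGap_nonneg (hc : IsCompact K) (hne : K.Nonempty) (hs : -K = K) (R : ℝ) :
    0 ≤ faceGap K R := by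
  obtain ⟨z, hz, hzX⟩ := exists_re_eq_halfWidth hc hne
  have h1 := sub_le_lowerSupport hc R hz
  have h2 := sub_le_lowerSupport hc (-R) (neg_mem_of_symm hs hz)
  rw [Complex.neg_re, Complex.neg_im] at h2
  rw [hzX] at h1 h2
  unfold faceGap
  linarith

theorem antitone_faceGap (hc : IsCompact K) (hne : K.Nonempty) (hs : -K = K) :
    Antitone (faceGap K) := by
  intro R S hRS
  have h1 := lowerSupport_le_add hc hne hs R S
  have h2 := lowerSupport_le_add hc hne hs (-R) (-S)
  rw [abs_of_nonneg (sub_nonneg.2 hRS)] at h1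
  rw [show -S - -R = -(S - R) by ring, abs_neg, abs_of_nonneg (sub_nonneg.2 hRS)] at h2
  unfold faceGap
  linarith

/-- The gap decreases and is bounded below, so the `limUnder` is a genuine limit. -/
theorem tendsto_faceGap (hc : IsCompact K) (hne : K.Nonempty) (hs : -K = K) :
    Tendsto (faceGap K) atTop (𝓝 (faceLength K)) :=
  tendsto_nhds_limUnder ⟨_, tendsto_atTop_ciInf (antitone_faceGap hc hne hs)
    ⟨0, by rintro _ ⟨R, rfl⟩; exact faceGap_nonneg hc hne hs R⟩⟩

theorem faceLength_nonneg (hc : IsCompact K) (hne : K.Nonempty) (hs : -K = K) :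
    0 ≤ faceLength K :=
  ge_of_tendsto' (tendsto_faceGap hc hne hs) (faceGap_nonneg hc hne hs)

/-! ### Integrability of the contact data in the slope. -/

theorem measurable_contactAbscissa (hc : IsCompact K) (hne : K.Nonempty) :
    Measurable (contactAbscissa K) :=
  (monotone_contactAbscissa hc hne).measurable

theorem integrable_halfWidth_sub_abs (hc : IsCompact K) (hne : K.Nonempty) (hs : -K = K) :
    Integrable fun m => halfWidth K - |contactAbscissa K m| := by
  have hmeas : Measurable fun m => halfWidth K - |contactAbscissa K m| :=
    measurable_const.sub ((measurable_contactAbscissa hc hne).norm)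
  have hnn : ∀ m, 0 ≤ halfWidth K - |contactAbscissa K m| := fun m =>
    sub_nonneg.2 (abs_contactAbscissa_le hc hne hs m)
  have hb : ∀ m, ‖halfWidth K - |contactAbscissa K m|‖ ≤ halfWidth K := fun m => by
    rw [Real.norm_eq_abs, abs_of_nonneg (hnn m)]
    linarith [abs_nonneg (contactAbscissa K m)]
  have hint : ∀ s t, IntervalIntegrable (fun m => halfWidth K - |contactAbscissa K m|)
      volume s t := fun s t =>
    (intervalIntegrable_const (c := halfWidth K)).mono_fun hmeas.aestronglyMeasurable
      (Eventually.of_forall fun m => (hb m).trans (le_abs_self _))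
  have hai : ∀ s t, IntervalIntegrable (contactAbscissa K) volume s t := fun s t =>
    (monotone_contactAbscissa hc hne).intervalIntegrable
  -- Bounding `-|a|` by `a` on `[-R, 0]` and by `-a` on `[0, R]`, the integral is at most `2 *
  -- lowerSupport K 0 - faceGap K R`.
  refine integrable_of_intervalIntegral_norm_bounded (2 * lowerSupport K 0) (a := fun R : ℝ => -R)
    (b := fun R => R) (fun R => ?_) tendsto_neg_atTop_atBot tendsto_id ?_ (l := atTop)
  · exact (hint (-R) R).1
  · filter_upwards [eventually_ge_atTop 0] with R hR
    simp_rw [Real.norm_eq_abs, abs_of_nonneg (hnn _)]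
    rw [← intervalIntegral.integral_add_adjacent_intervals (hint (-R) 0) (hint 0 R)]
    have e1 : ∫ m in (-R)..0, (halfWidth K - |contactAbscissa K m|) ≤
        ∫ m in (-R)..0, (halfWidth K + contactAbscissa K m) := by
      refine intervalIntegral.integral_mono_on (by linarith) (hint _ _)
        (intervalIntegrable_const.add (hai _ _)) fun m _ => ?_
      linarith [neg_abs_le (contactAbscissa K m)]
    have e2 : ∫ m in 0..R, (halfWidth K - |contactAbscissa K m|) ≤
        ∫ m in 0..R, (halfWidth K - contactAbscissa K m) := by
      refine intervalIntegral.integral_mono_on hR (hint _ _)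
        (intervalIntegrable_const.sub (hai _ _)) fun m _ => ?_
      linarith [le_abs_self (contactAbscissa K m)]
    rw [intervalIntegral.integral_add intervalIntegrable_const (hai _ _)] at e1
    rw [intervalIntegral.integral_sub intervalIntegrable_const (hai _ _)] at e2
    have f : ∀ s t, ∫ m in s..t, contactAbscissa K m = lowerSupport K t - lowerSupport K s :=
      (convexOn_lowerSupport hc hne).integral_rightDeriv
    rw [f, intervalIntegral.integral_const, smul_eq_mul] at e1 e2
    have := faceGap_nonneg hc hne hs R
    unfold faceGap at this
    linarith

theorem integrable_halfWidth_sub_max (hc : IsCompact K) (hne : K.Nonempty) (hs : -K = K) {x : ℝ}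
    (hx : x ≤ halfWidth K) :
    Integrable fun m => halfWidth K - max x |contactAbscissa K m| := by
  refine (integrable_halfWidth_sub_abs hc hne hs).mono' ?_ (Eventually.of_forall fun m => ?_)
  · exact (measurable_const.sub
      (measurable_const.max (measurable_contactAbscissa hc hne).norm)).aestronglyMeasurable
  · rw [Real.norm_eq_abs, abs_of_nonneg
      (sub_nonneg.2 (max_le hx (abs_contactAbscissa_le hc hne hs m)))]
    exact sub_le_sub_left (le_max_right _ _) _

/-! ### Vertical slices. -/

theorem exists_min_lowerSupport_sub (hc : IsCompact K) (hne : K.Nonempty) (hs : -K = K) {x : ℝ}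
    (hx : |x| < halfWidth K) :
    ∃ m₀, ∀ m, lowerSupport K m₀ - m₀ * x ≤ lowerSupport K m - m * x := by
  have hcont : Continuous fun m => lowerSupport K m - m * x :=
    (continuousOn_univ.1 ((convexOn_lowerSupport hc hne).continuousOn isOpen_univ)).sub (by fun_prop)
  obtain ⟨z, hz, hzX⟩ := exists_re_eq_halfWidth hc hne
  refine hcont.exists_forall_le ?_
  -- Coercivity: a rightmost point and its antipode bound the function below by this one, which
  -- grows since `|x| < halfWidth K`.
  have ht : Tendsto (fun m : ℝ => (halfWidth K - |x|) * ‖m‖ - |z.im|) (cocompact ℝ) atTop :=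
    tendsto_atTop_add_const_right _ _
      ((tendsto_norm_cocompact_atTop (E := ℝ)).const_mul_atTop (sub_pos.2 hx))
  refine tendsto_atTop_mono (fun m => ?_) ht
  have h1 := sub_le_lowerSupport hc m hz
  have h2 := sub_le_lowerSupport hc m (neg_mem_of_symm hs hz)
  rw [Complex.neg_re, Complex.neg_im] at h2
  rw [hzX] at h1 h2
  have h3 : m * x ≤ |x| * |m| := by rw [← abs_mul, mul_comm]; exact le_abs_self _
  rw [Real.norm_eq_abs]
  have h4 := le_abs_self z.im
  have h5 := neg_abs_le z.im
  rcases abs_cases m with ⟨e, -⟩ | ⟨e, -⟩ <;> rw [e] at h3 ⊢ <;> linarith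

/-- A separating line that is not vertical rescales to one of the slope conditions, the upper ones
being reached by symmetry. A vertical one is excluded by `|x| < halfWidth K`. -/
theorem mem_of_forall_slope (hc : IsCompact K) (hne : K.Nonempty) (hconv : Convex ℝ K)
    (hs : -K = K) {x y : ℝ} (hx : |x| < halfWidth K) (h1 : ∀ m, m * x - y ≤ lowerSupport K m)
    (h2 : ∀ m, y - m * x ≤ lowerSupport K m) : (⟨x, y⟩ : ℂ) ∈ K := by
  by_contra hp
  obtain ⟨φ, u, hu, hup⟩ := geometric_hahn_banach_closed_point hconv hc.isClosed hp
  have hφ : ∀ z : ℂ, φ z = φ 1 * z.re + φ Complex.I * z.im := fun z => by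
    conv_lhs => rw [← Complex.re_add_im z]
    rw [map_add, show (z.re : ℂ) = z.re • (1 : ℂ) by simp,
      show (z.im : ℂ) * Complex.I = z.im • Complex.I by simp, map_smul, map_smul]
    simp only [smul_eq_mul]
    ring
  have hu' : ∀ z ∈ K, -(φ 1 * z.re + φ Complex.I * z.im) < u := fun z hz => by
    rw [← hφ, ← map_neg]
    exact hu _ (neg_mem_of_symm hs hz)
  replace hu : ∀ z ∈ K, φ 1 * z.re + φ Complex.I * z.im < u := fun z hz =>
    (hφ z).symm.trans_lt (hu z hz)
  rw [hφ] at hup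
  dsimp only at hup
  rcases lt_trichotomy (φ Complex.I) 0 with hβ | hβ | hβ
  · have h : lowerSupport K (φ 1 / -φ Complex.I) ≤ u / -φ Complex.I := by
      refine supportFun_le hne _ fun z hz => ?_
      rw [slopeFunctional_apply, le_div_iff₀ (by linarith), sub_mul, mul_right_comm,
        div_mul_cancel₀ _ (by linarith)]
      linarith [hu z hz]
    have := (h1 _).trans h
    rw [le_div_iff₀ (by linarith), sub_mul, mul_right_comm, div_mul_cancel₀ _ (by linarith)] at this
    linarith
  · obtain ⟨z, hz, hzX⟩ := exists_re_eq_halfWidth hc hne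
    have e1 := hu z hz
    have e2 := hu' z hz
    rw [hβ, hzX] at e1 e2
    rw [hβ] at hup
    have e3 : φ 1 * x ≤ |φ 1| * halfWidth K := by
      refine (le_abs_self _).trans ?_
      rw [abs_mul]
      gcongr
    rcases abs_cases (φ 1) with ⟨e, -⟩ | ⟨e, -⟩ <;> rw [e] at e3 <;> linarith
  · have h : lowerSupport K (-φ 1 / φ Complex.I) ≤ u / φ Complex.I := by
      refine supportFun_le hne _ fun z hz => ?_
      rw [slopeFunctional_apply, le_div_iff₀ hβ, sub_mul, mul_right_comm,
        div_mul_cancel₀ _ hβ.ne']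
      linarith [hu' z hz]
    have := (h2 _).trans h
    rw [le_div_iff₀ hβ, sub_mul, mul_right_comm, div_mul_cancel₀ _ hβ.ne'] at this
    linarith

theorem convexOn_lowerSupport_sub (hc : IsCompact K) (hne : K.Nonempty) (x : ℝ) :
    ConvexOn ℝ univ fun m => lowerSupport K m - m * x := by
  refine (convexOn_lowerSupport hc hne).sub ?_
  exact (LinearMap.mulRight ℝ x).concaveOn convex_univ

theorem rightDeriv_lowerSupport_sub (hc : IsCompact K) (hne : K.Nonempty) (x m : ℝ) :
    derivWithin (fun m => lowerSupport K m - m * x) (Ioi m) m = contactAbscissa K m - x := by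
  refine HasDerivWithinAt.derivWithin ?_ (uniqueDiffWithinAt_Ioi m)
  refine ((convexOn_lowerSupport hc hne).hasDerivWithinAt_rightDeriv_univ m).sub ?_
  simpa using (hasDerivWithinAt_id m (Ioi m)).mul_const x

/-- The length of a vertical slice in terms of the lower support points. -/
theorem volume_slice (hc : IsCompact K) (hne : K.Nonempty) (hconv : Convex ℝ K) (hs : -K = K)
    {x : ℝ} (hx0 : 0 ≤ x) (hx : x < halfWidth K) :
    volume.real {y : ℝ | (⟨x, y⟩ : ℂ) ∈ K} =
      faceLength K + ∫ m, (halfWidth K - max x |contactAbscissa K m|) := by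
  have hx' : |x| < halfWidth K := by rwa [abs_of_nonneg hx0]
  obtain ⟨m₀, hm₀⟩ := exists_min_lowerSupport_sub hc hne hs hx'
  obtain ⟨m₁, hm₁⟩ := exists_min_lowerSupport_sub hc hne hs (x := -x) (by rwa [abs_neg])
  have hset : {y : ℝ | (⟨x, y⟩ : ℂ) ∈ K} =
      Icc (-(lowerSupport K m₀ - m₀ * x)) (lowerSupport K m₁ - m₁ * -x) := by
    ext y
    simp only [mem_ofPred_eq, mem_Icc]
    constructor
    · intro h
      have e1 := sub_le_lowerSupport hc m₀ h
      have e2 := sub_le_lowerSupport hc m₁ (neg_mem_of_symm hs h)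
      simp only [Complex.neg_re, Complex.neg_im] at e1 e2
      constructor <;> linarith
    · rintro ⟨e1, e2⟩
      refine mem_of_forall_slope hc hne hconv hs hx' (fun m => ?_) (fun m => ?_)
      · linarith [hm₀ m]
      · linarith [hm₁ m]
  set v := (lowerSupport K m₀ - m₀ * x) + (lowerSupport K m₁ - m₁ * -x) with hv
  have hint := integrable_halfWidth_sub_max hc hne hs hx.le
  have key : v = faceLength K + ∫ m, (halfWidth K - max x |contactAbscissa K m|) := by
    -- Once `[-R, R]` contains both minimisers, `faceGap K R` plus the integral over `[-R, R]`
    -- equals `v` exactly.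
    have ht := (tendsto_faceGap hc hne hs).add
      (intervalIntegral_tendsto_integral hint tendsto_neg_atTop_atBot tendsto_id)
    refine tendsto_nhds_unique (Tendsto.congr' ?_ tendsto_const_nhds) ht
    filter_upwards [eventually_ge_atTop |m₀|, eventually_ge_atTop |m₁|] with R h0 h1
    rw [abs_le] at h0 h1
    have e0 := (convexOn_lowerSupport_sub hc hne x).min_eq_sub_integral_posPart hm₀ h0.1 h0.2
    have e1 := (convexOn_lowerSupport_sub hc hne (-x)).min_eq_sub_integral_negPart hm₁ h1.1 h1.2
    simp_rw [rightDeriv_lowerSupport_sub hc hne] at e0 e1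
    have i0 : IntervalIntegrable (fun m => max (contactAbscissa K m - x) 0) volume (-R) R :=
      Monotone.intervalIntegrable fun s t hst => max_le_max
        (sub_le_sub_right (monotone_contactAbscissa hc hne hst) _) le_rfl
    have i1 : IntervalIntegrable (fun m => max (-(contactAbscissa K m - -x)) 0) volume (-R) R :=
      Antitone.intervalIntegrable fun s t hst => max_le_max
        (neg_le_neg (sub_le_sub_right (monotone_contactAbscissa hc hne hst) _)) le_rfl
    -- The excess of `|a|` over `x ≥ 0` splits into the parts with `a > x` and `a < -x`, one for
    -- each end of the slice.
    have e2 : ∀ m, halfWidth K - max x |contactAbscissa K m| = (halfWidth K - x) -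
        (max (contactAbscissa K m - x) 0 + max (-(contactAbscissa K m - -x)) 0) := by
      intro m
      rcases abs_cases (contactAbscissa K m) with ⟨e, h⟩ | ⟨e, h⟩ <;> rw [e] <;>
      rcases max_cases (contactAbscissa K m - x) 0 with ⟨e', h'⟩ | ⟨e', h'⟩ <;> rw [e'] <;>
      rcases max_cases (-(contactAbscissa K m - -x)) 0 with ⟨e', h'⟩ | ⟨e', h'⟩ <;> rw [e'] <;>
      rcases max_cases x (contactAbscissa K m) with ⟨e', h'⟩ | ⟨e', h'⟩ <;>
      rcases max_cases x (-contactAbscissa K m) with ⟨e', h'⟩ | ⟨e', h'⟩ <;> linarith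
    simp_rw [e2]
    rw [id, intervalIntegral.integral_sub intervalIntegrable_const (i0.add i1),
      intervalIntegral.integral_add i0 i1, hv, e0, e1, intervalIntegral.integral_const, faceGap,
      smul_eq_mul]
    ring
  have hv0 : 0 ≤ v := by
    rw [key]
    exact add_nonneg (faceLength_nonneg hc hne hs) (integral_nonneg fun m =>
      sub_nonneg.2 (max_le hx.le (abs_contactAbscissa_le hc hne hs m)))
  rw [hset, Real.volume_real_Icc, max_eq_left (by linarith), ← key, hv]
  ring

end

/-! ### Moments of a symmetric planar body -/

theorem integral_pow_mul_sub_max (q : ℕ) {X a : ℝ} (ha : |a| ≤ X) :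
    ∫ x in (0 : ℝ)..X, x ^ (2 * q) * (X - max x |a|) =
      (X ^ (2 * q + 2) - a ^ (2 * q + 2)) / ((2 * q + 1) * (2 * q + 2)) := by
  have hc : Continuous fun x : ℝ => x ^ (2 * q) * (X - max x |a|) := by fun_prop
  rw [← intervalIntegral.integral_add_adjacent_intervals (b := |a|) (hc.intervalIntegrable _ _)
    (hc.intervalIntegrable _ _)]
  have e1 : ∫ x in (0 : ℝ)..|a|, x ^ (2 * q) * (X - max x |a|) =
      ∫ x in (0 : ℝ)..|a|, x ^ (2 * q) * (X - |a|) := by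
    refine intervalIntegral.integral_congr fun x hx => ?_
    rw [uIcc_of_le (abs_nonneg a)] at hx
    simp only [max_eq_right hx.2]
  have e2 : ∫ x in |a|..X, x ^ (2 * q) * (X - max x |a|) =
      ∫ x in |a|..X, (x ^ (2 * q) * X - x ^ (2 * q + 1)) := by
    refine intervalIntegral.integral_congr fun x hx => ?_
    rw [uIcc_of_le ha] at hx
    simp only [max_eq_left hx.1]
    ring
  have i1 : Continuous fun x : ℝ => x ^ (2 * q) * X := by fun_prop
  have i2 : Continuous fun x : ℝ => x ^ (2 * q + 1) := by fun_prop
  rw [e1, e2, intervalIntegral.integral_sub (i1.intervalIntegrable _ _)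
    (i2.intervalIntegrable _ _), intervalIntegral.integral_mul_const,
    intervalIntegral.integral_mul_const, integral_pow, integral_pow, integral_pow,
    ← (even_two_mul (q + 1)).pow_abs (a := a) |>.trans (by ring_nf : _ = a ^ (2 * q + 2))]
  have h1 : (2 * (q : ℝ) + 1) ≠ 0 := by positivity
  have h2 : (2 * (q : ℝ) + 2) ≠ 0 := by positivity
  have h3 : (2 * (q : ℝ) + 1 + 1) ≠ 0 := by positivity
  push_cast
  rw [zero_pow (by omega)]
  field_simp
  ring

section

variable {K : Set ℂ}

theorem integral_re_pow_eq_integral_slice (hc : IsCompact K) (q : ℕ) :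
    ∫ z in K, z.re ^ (2 * q) =
      ∫ x : ℝ, x ^ (2 * q) * volume.real {y : ℝ | (⟨x, y⟩ : ℂ) ∈ K} := by
  have hint : Integrable (K.indicator fun z : ℂ => z.re ^ (2 * q)) := by
    rw [integrable_indicator_iff hc.measurableSet]
    exact (by fun_prop : Continuous fun z : ℂ => z.re ^ (2 * q)).continuousOn.integrableOn_compact hc
  have hmp := Complex.volume_preserving_equiv_real_prod.symm
  rw [← integral_indicator hc.measurableSet, ← hmp.integral_comp'
    (g := K.indicator fun z : ℂ => z.re ^ (2 * q)), Measure.volume_eq_prod, integral_prod]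
  · refine integral_congr_ae (Eventually.of_forall fun x => ?_)
    have hm : MeasurableSet {y : ℝ | (⟨x, y⟩ : ℂ) ∈ K} := by
      have : Measurable fun y : ℝ => (⟨x, y⟩ : ℂ) :=
        Complex.measurableEquivRealProd.symm.measurable.comp measurable_prodMk_left
      exact this hc.measurableSet
    have : ∀ y : ℝ, K.indicator (fun z : ℂ => z.re ^ (2 * q))
        (Complex.measurableEquivRealProd.symm (x, y)) =
        {y : ℝ | (⟨x, y⟩ : ℂ) ∈ K}.indicator (fun _ => x ^ (2 * q)) y := fun y => by
      simp only [indicator, mem_ofPred_eq]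
      rfl
    simp only [this]
    rw [integral_indicator_const _ hm, smul_eq_mul, mul_comm]
  · rw [← Measure.volume_eq_prod]
    exact hmp.integrable_comp_of_integrable hint

theorem integrable_halfWidth_pow_sub_pow (hc : IsCompact K) (hne : K.Nonempty) (hs : -K = K)
    (q : ℕ) :
    Integrable fun m => halfWidth K ^ (2 * q + 2) - contactAbscissa K m ^ (2 * q + 2) := by
  have hmeas : Measurable fun m =>
      halfWidth K ^ (2 * q + 2) - contactAbscissa K m ^ (2 * q + 2) :=
    measurable_const.sub ((measurable_contactAbscissa hc hne).pow_const _)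
  -- Factor `X ^ n - |a| ^ n` as `X - |a|` times `n = 2 * q + 2` terms, each at most `X ^ (n - 1)`.
  refine ((integrable_halfWidth_sub_abs hc hne hs).const_mul
    ((2 * q + 2 : ℕ) * halfWidth K ^ (2 * q + 1))).mono' hmeas.aestronglyMeasurable
    (Eventually.of_forall fun m => ?_)
  have hX := halfWidth_nonneg hc hne hs
  have ha := abs_contactAbscissa_le hc hne hs m
  rw [← Even.pow_abs (by simp [parity_simps] : Even (2 * q + 2)) (contactAbscissa K m),
    Real.norm_eq_abs, abs_of_nonneg (sub_nonneg.2 (pow_le_pow_left₀ (abs_nonneg _) ha _)),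
    ← Commute.geom_sum₂_mul (Commute.all _ _)]
  refine mul_le_mul_of_nonneg_right ?_ (sub_nonneg.2 ha)
  refine (Finset.sum_le_card_nsmul _ _ (halfWidth K ^ (2 * q + 1)) fun i hi => ?_).trans ?_
  · have hi' : i + (2 * q + 2 - 1 - i) = 2 * q + 1 := by
      have := Finset.mem_range.1 hi
      omega
    rw [← hi', pow_add]
    gcongr
  · simp

/-- Justifies exchanging the integrals over abscissa and slope; the dominating function is a
product. -/
theorem integrable_slice_kernel (hc : IsCompact K) (hne : K.Nonempty) (hs : -K = K) (q : ℕ) :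
    Integrable (Function.uncurry fun x m : ℝ =>
      x ^ (2 * q) * (halfWidth K - max x |contactAbscissa K m|))
      ((volume.restrict (Ioo 0 (halfWidth K))).prod volume) := by
  have hdom : Integrable (fun p : ℝ × ℝ => halfWidth K ^ (2 * q) *
      (halfWidth K - |contactAbscissa K p.2|))
      ((volume.restrict (Ioo 0 (halfWidth K))).prod volume) :=
    Integrable.mul_prod (f := fun _ => halfWidth K ^ (2 * q)) (integrable_const _)
      (integrable_halfWidth_sub_abs hc hne hs)
  have hmeas : Measurable (Function.uncurry fun x m : ℝ =>
      x ^ (2 * q) * (halfWidth K - max x |contactAbscissa K m|)) :=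
    (measurable_fst.pow_const _).mul (measurable_const.sub (measurable_fst.max
      ((measurable_contactAbscissa hc hne).comp measurable_snd).norm))
  refine hdom.mono' hmeas.aestronglyMeasurable ?_
  have hr : (volume.restrict (Ioo 0 (halfWidth K))).prod (volume : Measure ℝ) =
      (volume.prod volume).restrict (Ioo 0 (halfWidth K) ×ˢ univ) := by
    rw [← Measure.prod_restrict, Measure.restrict_univ]
  rw [hr]
  filter_upwards [ae_restrict_mem (measurableSet_Ioo.prod MeasurableSet.univ)] with p hp
  have hx := hp.1
  have hn : 0 ≤ halfWidth K - max p.1 |contactAbscissa K p.2| :=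
    sub_nonneg.2 (max_le hx.2.le (abs_contactAbscissa_le hc hne hs _))
  rw [Function.uncurry_def, Real.norm_eq_abs,
    abs_of_nonneg (mul_nonneg (pow_nonneg hx.1.le _) hn)]
  refine mul_le_mul (pow_le_pow_left₀ hx.1.le hx.2.le _) ?_ hn
    (pow_nonneg (halfWidth_nonneg hc hne hs) _)
  exact sub_le_sub_left (le_max_right _ _) _

/-- Even moments of a symmetric body in terms of Minkowski-additive data. -/
theorem integral_re_pow (hc : IsCompact K) (hne : K.Nonempty) (hconv : Convex ℝ K) (hs : -K = K)
    (q : ℕ) :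
    ∫ z in K, z.re ^ (2 * q) =
      2 / (2 * q + 1) * (faceLength K * halfWidth K ^ (2 * q + 1)) +
      2 / ((2 * q + 1) * (2 * q + 2)) *
        ∫ m, (halfWidth K ^ (2 * q + 2) - contactAbscissa K m ^ (2 * q + 2)) := by
  set X := halfWidth K with hX
  have hX0 : 0 ≤ X := halfWidth_nonneg hc hne hs
  -- Central symmetry makes the slice length even in `x`, which produces the factor 2.
  have habs : ∀ x : ℝ, x ^ (2 * q) * volume.real {y : ℝ | (⟨x, y⟩ : ℂ) ∈ K} =
      |x| ^ (2 * q) * volume.real {y : ℝ | (⟨|x|, y⟩ : ℂ) ∈ K} := by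
    intro x
    rw [(even_two_mul q).pow_abs]
    congr 1
    rcases abs_choice x with h | h <;> rw [h]
    rw [Measure.real, Measure.real, ← Measure.measure_neg]
    congr 2
    ext y
    simp only [Set.mem_neg, mem_ofPred_eq]
    have e : ∀ u v : ℝ, -(⟨u, v⟩ : ℂ) = ⟨-u, -v⟩ := fun u v => rfl
    constructor <;> intro h' <;> simpa [e] using neg_mem_of_symm hs h'
  rw [integral_re_pow_eq_integral_slice hc, integral_congr_ae (Eventually.of_forall habs),
    integral_comp_abs (f := fun x => x ^ (2 * q) * volume.real {y : ℝ | (⟨x, y⟩ : ℂ) ∈ K})]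
  have h1 : ∫ x in Ioi (0 : ℝ), x ^ (2 * q) * volume.real {y : ℝ | (⟨x, y⟩ : ℂ) ∈ K} =
      ∫ x in Ioc 0 X, x ^ (2 * q) * volume.real {y : ℝ | (⟨x, y⟩ : ℂ) ∈ K} := by
    refine setIntegral_eq_of_subset_of_forall_sdiff_eq_zero measurableSet_Ioi
      Ioc_subset_Ioi_self fun x hx => ?_
    have hxX : X < x := by
      by_contra h
      exact hx.2 ⟨hx.1, not_lt.1 h⟩
    have : {y : ℝ | (⟨x, y⟩ : ℂ) ∈ K} = ∅ := by
      refine eq_empty_of_forall_notMem fun y hy => ?_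
      exact absurd ((le_abs_self _).trans (abs_re_le_halfWidth hc hs hy)) (not_le.2 hxX)
    rw [this, measureReal_empty, mul_zero]
  -- The interval is open because `volume_slice` needs `x < X`; the endpoint is null.
  have h2 : ∫ x in Ioo 0 X, x ^ (2 * q) * volume.real {y : ℝ | (⟨x, y⟩ : ℂ) ∈ K} =
      ∫ x in Ioo 0 X, (x ^ (2 * q) * faceLength K +
        ∫ m, x ^ (2 * q) * (X - max x |contactAbscissa K m|)) := by
    refine setIntegral_congr_fun measurableSet_Ioo fun x hx => ?_
    rw [volume_slice hc hne hconv hs hx.1.le hx.2, mul_add, integral_const_mul]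
  have hk : Integrable (Function.uncurry fun x m : ℝ =>
      x ^ (2 * q) * (X - max x |contactAbscissa K m|)) ((volume.restrict (Ioo 0 X)).prod volume) :=
    integrable_slice_kernel hc hne hs q
  have h3 : Integrable (fun x : ℝ => x ^ (2 * q) * faceLength K) (volume.restrict (Ioo 0 X)) :=
    ((by fun_prop : Continuous fun x : ℝ => x ^ (2 * q) * faceLength K).continuousOn.integrableOn_Icc
      (a := 0) (b := X)).mono_set Ioo_subset_Icc_self
  have h5 : Integrable (fun x : ℝ => ∫ m, x ^ (2 * q) * (X - max x |contactAbscissa K m|))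
      (volume.restrict (Ioo 0 X)) := hk.integral_prod_left
  rw [h1, integral_Ioc_eq_integral_Ioo, h2, integral_add h3 h5,
    integral_integral_swap hk]
  have h4 : ∀ m, ∫ x in Ioo 0 X, x ^ (2 * q) * (X - max x |contactAbscissa K m|) =
      (X ^ (2 * q + 2) - contactAbscissa K m ^ (2 * q + 2)) / ((2 * q + 1) * (2 * q + 2)) := by
    intro m
    rw [← integral_pow_mul_sub_max q (abs_contactAbscissa_le hc hne hs m),
      intervalIntegral.integral_of_le hX0, integral_Ioc_eq_integral_Ioo]
  rw [integral_congr_ae (Eventually.of_forall h4)]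
  rw [integral_mul_const, ← integral_Ioc_eq_integral_Ioo, ← intervalIntegral.integral_of_le hX0,
    integral_pow, integral_div, zero_pow (by omega)]
  push_cast
  ring

end

/-! ### Polynomials with nonnegative coefficients -/

namespace MvPolynomial

variable {σ R : Type*} [CommSemiring R] [PartialOrder R] [IsOrderedRing R]

/-- All coefficients of the polynomial are nonnegative. -/
def NonnegCoeffs (p : MvPolynomial σ R) : Prop := ∀ d, 0 ≤ coeff d p

theorem NonnegCoeffs.add {p r : MvPolynomial σ R} (hp : NonnegCoeffs p) (hr : NonnegCoeffs r) :
    NonnegCoeffs (p + r) := fun d => by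
  rw [coeff_add]; exact add_nonneg (hp d) (hr d)

theorem NonnegCoeffs.mul {p r : MvPolynomial σ R} (hp : NonnegCoeffs p) (hr : NonnegCoeffs r) :
    NonnegCoeffs (p * r) := fun d => by
  classical
  rw [coeff_mul]; exact Finset.sum_nonneg fun x _ => mul_nonneg (hp _) (hr _)

omit [IsOrderedRing R] in
theorem nonnegCoeffs_C {c : R} (hc : 0 ≤ c) : NonnegCoeffs (C c : MvPolynomial σ R) := fun d => by
  classical
  rw [coeff_C]; split_ifs <;> simp [hc]

theorem nonnegCoeffs_X (i : σ) : NonnegCoeffs (X i : MvPolynomial σ R) := fun d => by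
  classical
  rw [coeff_X]; split_ifs <;> simp

theorem nonnegCoeffs_sum {ι : Type*} (s : Finset ι) {p : ι → MvPolynomial σ R}
    (hp : ∀ i ∈ s, NonnegCoeffs (p i)) : NonnegCoeffs (∑ i ∈ s, p i) := fun d => by
  rw [coeff_sum]; exact Finset.sum_nonneg fun i hi => hp i hi d

theorem nonnegCoeffs_prod {ι : Type*} (s : Finset ι) {p : ι → MvPolynomial σ R}
    (hp : ∀ i ∈ s, NonnegCoeffs (p i)) : NonnegCoeffs (∏ i ∈ s, p i) :=
  Finset.prod_induction _ NonnegCoeffs (fun _ _ => NonnegCoeffs.mul)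
    (C_1 (R := R) (σ := σ) ▸ nonnegCoeffs_C zero_le_one) hp

theorem NonnegCoeffs.pow {p : MvPolynomial σ R} (hp : NonnegCoeffs p) (n : ℕ) :
    NonnegCoeffs (p ^ n) := by
  rw [← Finset.card_range n, ← Finset.prod_const]
  exact nonnegCoeffs_prod _ fun _ _ => hp

end MvPolynomial

/-! ### Moments of Minkowski combinations -/

section

variable {ι : Type*} [Fintype ι] {K : ι → Set ℂ}

theorem supportFun_combination (hc : ∀ i, IsCompact (K i)) (hne : ∀ i, (K i).Nonempty)
    {l : ι → ℝ} (hl : ∀ i, 0 ≤ l i) (φ : ℂ →L[ℝ] ℝ) :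
    supportFun (∑ i, l i • K i) φ = ∑ i, l i * supportFun (K i) φ := by
  rw [supportFun_finsetSum_set _ _ (fun i _ => (hc i).smul (l i)) fun i _ => (hne i).smul_set]
  exact Finset.sum_congr rfl fun i _ => supportFun_smul_set φ (hl i)

/-- Support functions add, and one-sided derivatives exist at every slope, so this holds without
exceptional `m`. -/
theorem contactAbscissa_combination (hc : ∀ i, IsCompact (K i)) (hne : ∀ i, (K i).Nonempty)
    {l : ι → ℝ} (hl : ∀ i, 0 ≤ l i) (m : ℝ) :
    contactAbscissa (∑ i, l i • K i) m = ∑ i, l i * contactAbscissa (K i) m := by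
  have h : lowerSupport (∑ i, l i • K i) = fun m => ∑ i, l i * lowerSupport (K i) m :=
    funext fun m => supportFun_combination hc hne hl _
  rw [contactAbscissa, h]
  refine HasDerivWithinAt.derivWithin ?_ (uniqueDiffWithinAt_Ioi m)
  exact HasDerivWithinAt.fun_sum fun i _ =>
    ((convexOn_lowerSupport (hc i) (hne i)).hasDerivWithinAt_rightDeriv_univ m).const_mul (l i)

theorem isCompact_combination (hc : ∀ i, IsCompact (K i)) (l : ι → ℝ) :
    IsCompact (∑ i, l i • K i) :=
  isCompact_finsetSum_set _ _ fun i _ => (hc i).smul (l i)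

theorem nonempty_combination (hne : ∀ i, (K i).Nonempty) (l : ι → ℝ) :
    (∑ i, l i • K i).Nonempty :=
  nonempty_finsetSum_set _ _ fun i _ => (hne i).smul_set

theorem convex_combination (hconv : ∀ i, Convex ℝ (K i)) (l : ι → ℝ) :
    Convex ℝ (∑ i, l i • K i) :=
  convex_finsetSum_set _ _ fun i _ => (hconv i).smul (l i)

theorem neg_combination (hs : ∀ i, -K i = K i) (l : ι → ℝ) :
    -(∑ i, l i • K i) = ∑ i, l i • K i :=
  neg_finsetSum_set _ _ fun i _ => by rw [← smul_set_neg, hs i]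

theorem faceLength_combination (hc : ∀ i, IsCompact (K i)) (hne : ∀ i, (K i).Nonempty)
    (hs : ∀ i, -K i = K i) {l : ι → ℝ} (hl : ∀ i, 0 ≤ l i) :
    faceLength (∑ i, l i • K i) = ∑ i, l i * faceLength (K i) := by
  refine tendsto_nhds_unique (tendsto_faceGap (isCompact_combination hc l)
    (nonempty_combination hne l) (neg_combination hs l)) ?_
  have h : faceGap (∑ i, l i • K i) = fun R => ∑ i, l i * faceGap (K i) R := by
    funext R
    simp only [faceGap, lowerSupport, halfWidth, supportFun_combination hc hne hl,
      Finset.mul_sum, ← Finset.sum_add_distrib, ← Finset.sum_sub_distrib]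
    exact Finset.sum_congr rfl fun i _ => by ring
  rw [h]
  exact tendsto_finsetSum _ fun i _ => (tendsto_faceGap (hc i) (hne i) (hs i)).const_mul (l i)

omit [Fintype ι] in
theorem prod_contactAbscissa_le (hc : ∀ i, IsCompact (K i)) (hne : ∀ i, (K i).Nonempty)
    (hs : ∀ i, -K i = K i) {n : ℕ} (g : Fin n → ι) (m : ℝ) :
    ∏ k, contactAbscissa (K (g k)) m ≤ ∏ k, halfWidth (K (g k)) := by
  refine (le_abs_self _).trans ?_
  rw [Finset.abs_prod]
  exact Finset.prod_le_prod (fun k _ => abs_nonneg _) fun k _ =>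
    abs_contactAbscissa_le (hc _) (hne _) (hs _) m

/-- Both powers are expanded over words `g` in the indices, so the monomials in `l` match and each
difference is nonnegative by `prod_contactAbscissa_le`. -/
theorem pow_sub_pow_combination (hc : ∀ i, IsCompact (K i)) (hne : ∀ i, (K i).Nonempty)
    {l : ι → ℝ} (hl : ∀ i, 0 ≤ l i) (n : ℕ) (m : ℝ) :
    halfWidth (∑ i, l i • K i) ^ n - contactAbscissa (∑ i, l i • K i) m ^ n =
      ∑ g : Fin n → ι, (∏ k, l (g k)) *
        (∏ k, halfWidth (K (g k)) - ∏ k, contactAbscissa (K (g k)) m) := by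
  rw [contactAbscissa_combination hc hne hl, halfWidth, supportFun_combination hc hne hl,
    Fintype.sum_pow, Fintype.sum_pow, ← Finset.sum_sub_distrib]
  refine Finset.sum_congr rfl fun g _ => ?_
  rw [Finset.prod_mul_distrib, Finset.prod_mul_distrib, mul_sub]
  rfl

theorem integrable_prod_sub_prod (hc : ∀ i, IsCompact (K i)) (hne : ∀ i, (K i).Nonempty)
    (hs : ∀ i, -K i = K i) (q : ℕ) (g : Fin (2 * q + 2) → ι) :
    Integrable fun m => ∏ k, halfWidth (K (g k)) - ∏ k, contactAbscissa (K (g k)) m := by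
  -- With all weights 1, the term of `g` is one nonnegative summand of an integrable sum.
  have hT := integrable_halfWidth_pow_sub_pow (isCompact_combination hc fun _ => 1)
    (nonempty_combination hne fun _ => 1) (neg_combination hs fun _ => 1) q
  refine hT.mono' ?_ (Eventually.of_forall fun m => ?_)
  · exact (measurable_const.sub (Finset.measurable_prod _ fun k _ =>
      measurable_contactAbscissa (hc _) (hne _))).aestronglyMeasurable
  · have hnn : ∀ g : Fin (2 * q + 2) → ι,
        0 ≤ ∏ k, halfWidth (K (g k)) - ∏ k, contactAbscissa (K (g k)) m := fun g =>
      sub_nonneg.2 (prod_contactAbscissa_le hc hne hs g m)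
    rw [pow_sub_pow_combination hc hne (fun _ => zero_le_one), Real.norm_eq_abs,
      abs_of_nonneg (hnn g)]
    simp only [Finset.prod_const_one, one_mul]
    exact Finset.single_le_sum (f := fun g : Fin (2 * q + 2) → ι =>
      ∏ k, halfWidth (K (g k)) - ∏ k, contactAbscissa (K (g k)) m) (fun g _ => hnn g)
      (Finset.mem_univ g)

open MvPolynomial in
/-- One-directional even moments of Minkowski combinations are polynomials with nonnegative
coefficients. -/
theorem exists_nonnegCoeffs_integral_re_pow (hc : ∀ i, IsCompact (K i))
    (hne : ∀ i, (K i).Nonempty) (hconv : ∀ i, Convex ℝ (K i)) (hs : ∀ i, -K i = K i) (q : ℕ) :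
    ∃ p : MvPolynomial ι ℝ, NonnegCoeffs p ∧ ∀ l : ι → ℝ, (∀ i, 0 ≤ l i) →
      ∫ z in ∑ i, l i • K i, z.re ^ (2 * q) = eval l p := by
  -- The witness is `integral_re_pow` with the linear forms in `l` substituted.
  refine ⟨C (2 / (2 * q + 1) : ℝ) * ((∑ i, X i * C (faceLength (K i))) *
      (∑ i, X i * C (halfWidth (K i))) ^ (2 * q + 1)) +
      C (2 / ((2 * q + 1) * (2 * q + 2)) : ℝ) * ∑ g : Fin (2 * q + 2) → ι,
        (∏ k, X (g k)) *
          C (∫ m, (∏ k, halfWidth (K (g k)) - ∏ k, contactAbscissa (K (g k)) m)), ?_, fun l hl => ?_⟩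
  · refine NonnegCoeffs.add (NonnegCoeffs.mul (nonnegCoeffs_C (by positivity)) (NonnegCoeffs.mul
      (nonnegCoeffs_sum _ fun i _ => ?_) (NonnegCoeffs.pow (nonnegCoeffs_sum _ fun i _ => ?_) _)))
      (NonnegCoeffs.mul (nonnegCoeffs_C (by positivity)) (nonnegCoeffs_sum _ fun g _ => ?_))
    · exact (nonnegCoeffs_X i).mul (nonnegCoeffs_C (faceLength_nonneg (hc i) (hne i) (hs i)))
    · exact (nonnegCoeffs_X i).mul (nonnegCoeffs_C (halfWidth_nonneg (hc i) (hne i) (hs i)))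
    · exact (nonnegCoeffs_prod _ fun k _ => nonnegCoeffs_X _).mul
        (nonnegCoeffs_C (integral_nonneg fun m =>
          sub_nonneg.2 (prod_contactAbscissa_le hc hne hs g m)))
  · rw [integral_re_pow (isCompact_combination hc l) (nonempty_combination hne l)
      (convex_combination hconv l) (neg_combination hs l)]
    simp_rw [pow_sub_pow_combination hc hne hl]
    rw [integral_finsetSum _ fun g _ => (integrable_prod_sub_prod hc hne hs q g).const_mul _,
      faceLength_combination hc hne hs hl, halfWidth, supportFun_combination hc hne hl]
    simp_rw [integral_const_mul]
    simp only [map_add, map_mul, map_sum, map_pow, map_prod, eval_C, eval_X]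
    rfl

end

/-! ### Powers of the norm as averages over directions -/

/-- An even power of the modulus is a positive multiple of a sum of even powers of the real parts
of equally spaced rotations. -/
theorem exists_norm_pow_eq_sum_re_pow (q : ℕ) :
    ∃ (c : ℝ) (ω : Fin (q + 1) → Circle), 0 ≤ c ∧ ∀ z : ℂ,
      ‖z‖ ^ (2 * q) = c * ∑ j, ((ω j : ℂ) * z).re ^ (2 * q) := by
  -- With this step the frequencies `2 * (k - q)` give `(q + 1)`-th roots of unity, trivial only for
  -- `k = q` because `|k - q| ≤ q`.
  set t : ℝ := Real.pi / (q + 1) with ht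
  have hq : (q : ℝ) + 1 ≠ 0 := by positivity
  -- Only the middle binomial term survives summation over `j`, once for each of the `q + 1`
  -- rotations; `2 ^ (2 * q)` clears the halves in `re w = (w + conj w) / 2`.
  set A : ℝ := (q + 1) * (2 * q).choose q with hA
  have hApos : 0 < A := by
    have : 0 < (2 * q).choose q := Nat.choose_pos (by omega)
    positivity
  refine ⟨2 ^ (2 * q) / A, fun j => Circle.exp (j * t), by positivity, fun z => ?_⟩
  rw [div_mul_eq_mul_div, eq_div_iff hApos.ne', Finset.mul_sum]
  have hre : ∀ j : Fin (q + 1), ((2 ^ (2 * q) * (((Circle.exp (j * t) : Circle) : ℂ) * z).re ^ (2 * q)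
      : ℝ) : ℂ) = ∑ k ∈ Finset.range (2 * q + 1), z ^ k * (starRingEnd ℂ z) ^ (2 * q - k) *
        ((2 * q).choose k) * Complex.exp ((2 * k - 2 * q : ℤ) * t * Complex.I) ^ (j : ℕ) := by
    intro j
    push_cast
    rw [← mul_pow, Complex.re_eq_add_conj, mul_div_cancel₀ _ (two_ne_zero), map_mul,
      ← Complex.exp_conj, add_pow]
    refine Finset.sum_congr rfl fun k hk => ?_
    have hk' : k ≤ 2 * q := by have := Finset.mem_range.1 hk; omega
    rw [mul_pow, mul_pow, ← Complex.exp_nat_mul, ← Complex.exp_nat_mul, ← Complex.exp_nat_mul]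
    have e : Complex.exp (j * ((2 * k - 2 * q) * t * Complex.I)) =
        Complex.exp (k * (j * t * Complex.I)) *
        Complex.exp ((2 * q - k : ℕ) * (starRingEnd ℂ) (j * t * Complex.I)) := by
      rw [← Complex.exp_add]
      congr 1
      rw [map_mul, map_mul, Complex.conj_ofReal, Complex.conj_natCast, Complex.conj_I]
      push_cast [hk']
      ring
    rw [e]
    ring
  have hz : ((‖z‖ ^ (2 * q) : ℝ) : ℂ) = z ^ q * (starRingEnd ℂ z) ^ q := by
    rw [← mul_pow, Complex.mul_conj, Complex.normSq_eq_norm_sq]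
    push_cast
    rw [← pow_mul]
  apply Complex.ofReal_injective
  rw [Complex.ofReal_mul, hz, Complex.ofReal_sum, Finset.sum_congr rfl fun j _ => hre j,
    Finset.sum_comm]
  simp_rw [← Finset.mul_sum]
  rw [Finset.sum_eq_single q]
  · have : ∀ i : Fin (q + 1), Complex.exp ((2 * q - 2 * q : ℤ) * t * Complex.I) ^ (i : ℕ) = 1 := by
      simp
    rw [Finset.sum_congr rfl fun i _ => this i, show 2 * q - q = q by omega]
    simp [hA]
    ring
  · intro k hk hkq
    have hk' : k < 2 * q + 1 := Finset.mem_range.1 hk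
    rw [Fin.sum_univ_eq_sum_range (fun i =>
      Complex.exp ((2 * k - 2 * q : ℤ) * t * Complex.I) ^ i) (q + 1)]
    have hne : Complex.exp ((2 * k - 2 * q : ℤ) * t * Complex.I) ≠ 1 := by
      intro h
      obtain ⟨n, hn⟩ := Complex.exp_eq_one_iff.1 h
      have h1 : ((2 * k - 2 * q : ℤ) : ℝ) * t = n * (2 * Real.pi) := by
        have : (((2 * k - 2 * q : ℤ) * t : ℝ) : ℂ) * Complex.I =
            ((n * (2 * Real.pi) : ℝ) : ℂ) * Complex.I := by
          push_cast at hn ⊢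
          rw [hn]; ring
        exact_mod_cast mul_right_cancel₀ Complex.I_ne_zero this
      rw [ht, mul_div_assoc', div_eq_iff hq] at h1
      have h2 : ((k : ℝ) - q) = n * (q + 1) := by
        have : ((k : ℝ) - q) * (2 * Real.pi) = n * (q + 1) * (2 * Real.pi) := by
          push_cast at h1
          linarith
        exact mul_right_cancel₀ (by positivity) this
      have h3 : ((k : ℤ) - q) = n * (q + 1) := by exact_mod_cast h2
      rcases lt_trichotomy n 0 with hn0 | hn0 | hn0
      · nlinarith
      · subst hn0
        apply hkq
        omega
      · nlinarith
    have hone : Complex.exp ((2 * k - 2 * q : ℤ) * t * Complex.I) ^ (q + 1) = 1 := by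
      rw [← Complex.exp_nat_mul, Complex.exp_eq_one_iff]
      refine ⟨k - q, ?_⟩
      have hq' : (q : ℂ) + 1 ≠ 0 := by exact_mod_cast hq
      rw [ht]
      push_cast
      field_simp
    rw [geom_sum_eq hne, hone]
    simp
  · intro h
    exact absurd (Finset.mem_range.2 (by omega)) h

/-! ### Transfer from the complex plane to the Euclidean plane. -/

open MvPolynomial in
theorem theorem6p2 (q m : ℕ) (K : Fin m → Set (EuclideanSpace ℝ (Fin 2)))
    (hcompact : ∀ i, IsCompact (K i))
    (hconvex : ∀ i, Convex ℝ (K i))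
    (hsymm : ∀ i, -(K i) = K i) :
    ∃ p : MvPolynomial (Fin m) ℝ,
      (∀ d : Fin m →₀ ℕ, 0 ≤ MvPolynomial.coeff d p) ∧
      ∀ l : Fin m → ℝ, (∀ i, 0 ≤ l i) →
        ∫ s in ∑ i, l i • K i, ‖s‖ ^ (2 * q) ∂(volume : Measure (EuclideanSpace ℝ (Fin 2))) =
          MvPolynomial.eval l p := by
  by_cases hne : ∀ i, (K i).Nonempty
  · obtain ⟨c, ω, hc0, hω⟩ := exists_norm_pow_eq_sum_re_pow q
    let T : Fin (q + 1) → (EuclideanSpace ℝ (Fin 2) ≃ₗᵢ[ℝ] ℂ) := fun j =>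
      Complex.orthonormalBasisOneI.repr.symm.trans (rotation (ω j))
    have hT : ∀ s, ‖s‖ ^ (2 * q) = c * ∑ j, (T j s).re ^ (2 * q) := fun s => by
      rw [← LinearIsometryEquiv.norm_map Complex.orthonormalBasisOneI.repr.symm s, hω]
      rfl
    have hP : ∀ j, ∃ p : MvPolynomial (Fin m) ℝ, NonnegCoeffs p ∧ ∀ l : Fin m → ℝ,
        (∀ i, 0 ≤ l i) → ∫ z in ∑ i, l i • (T j '' K i), z.re ^ (2 * q) = eval l p := fun j =>
      exists_nonnegCoeffs_integral_re_pow (fun i => (hcompact i).image (T j).continuous)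
        (fun i => (hne i).image _)
        (fun i => (hconvex i).linear_image ((T j).toLinearEquiv : _ →ₗ[ℝ] ℂ))
        (fun i => by rw [← image_neg_of_apply_neg_eq_neg (fun x _ => map_neg (T j) x), hsymm i]) q
    choose P hP0 hP1 using hP
    refine ⟨C c * ∑ j, P j, (nonnegCoeffs_C hc0).mul (nonnegCoeffs_sum _ fun j _ => hP0 j),
      fun l hl => ?_⟩
    have hint : ∀ j, Integrable (fun s => (T j s).re ^ (2 * q))
        (volume.restrict (∑ i, l i • K i)) := fun j =>
      ((Complex.continuous_re.comp (T j).continuous).pow (2 * q)).continuousOn.integrableOn_compact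
        (isCompact_finsetSum_set _ _ fun i _ => (hcompact i).smul (l i))
    simp_rw [hT]
    rw [integral_const_mul, integral_finsetSum _ fun j _ => hint j]
    simp only [map_mul, map_sum, eval_C]
    congr 1
    refine Finset.sum_congr rfl fun j _ => ?_
    have hTS : T j '' (∑ i, l i • K i) = ∑ i, l i • (T j '' K i) := by
      rw [image_finsetSum]
      exact Finset.sum_congr rfl fun i _ => image_smul_set ..
    rw [← hP1 j l hl, ← hTS]
    exact ((T j).measurePreserving.setIntegral_image_emb
      (T j).toHomeomorph.measurableEmbedding (fun z => z.re ^ (2 * q)) _).symm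
  -- An empty `K i` makes the whole sum empty, even when `l i = 0`, so the zero polynomial works.
  · push Not at hne
    obtain ⟨i, hi⟩ := hne
    refine ⟨0, by simp, fun l _ => ?_⟩
    rw [← Finset.add_sum_erase _ _ (Finset.mem_univ i), hi]
    simp
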